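/- All graphs are finite and simple. For a graph $G$ and an integer $r\ge 1$, the $r$-blowup $G^{(r)}$ is obtained by replacing each vertex $u$ of $G$ by an independent set $R_u$ of $r$ vertices (a cluster) and each edge $uw$ by all edges between $R_u$ and $R_w$. Starting from a set $B\subseteq V(G^{(r)})$ of blue vertices (all others white), the following rule is applied repeatedly: if $B_t$ is the current set of blue vertices, $u\in B_t$, and $W$ is the vertex set of a connected component of $G^{(r)}-B_t$ with $|N(u)\cap W|\le r$, then all vertices of $N(u)\cap W$ may be coloured blue. If all of $G^{(r)}$ can be made blue, $B$ is an $r$-fold PSD forcing set for $G$. Let $Z_{[r]}^+(G)$ be the minimum cardinality of such a set and $Z_f^+(G)=\inf_{r\ge 1} Z_{[r]}^+(G)/r$. With respect to $B$, a cluster is an All cluster if all its vertices are blue, a One cluster if exactly one of its vertices is blue and the others (at least one) are white, and a None cluster if all its vertices are white; $a(B)$ and $\ell(B)$ are the numbers of All and One clusters. An optimal All-One-None $r$-fold PSD forcing set is an $r$-fold PSD forcing set $B$ of cardinality $Z_{[r]}^+(G)$ for which every cluster is an All, One or None cluster, and from which $G^{(r)}$ can be made blue by a sequence of applications of the rule in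 each of which the newly coloured vertices form a nonempty subset of a single cluster. **Theorem.** Let $G$ be a graph and $n=|G|$ its order. Then optimal All-One-None $n$-fold PSD forcing sets for $G$ exist, and all of them have the same number $a^{*+}(G)$ of All clusters and the same number $\ell^{*+}(G)$ of One clusters. Moreover $$Z_f^+(G)=a^{*+}(G);$$ in particular $Z_f^+(G)$ is a nonnegative integer. Furthermore $Z_{[r]}^+(G)=r\cdot a^{*+}(G)+\ell^{*+}(G)$ for every $r\ge n$. -/

import Mathlib

namespace FracPSD

universe u

variable {V : Type u}

/-- The `r`-blowup of `G`: every vertex `v` is replaced by an independent set of `r` vertices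
`(v, i)`, and every edge by the edges of a complete bipartite graph. -/
def blowup (G : SimpleGraph V) (r : ℕ) : SimpleGraph (V × Fin r) where
  Adj x y := G.Adj x.1 y.1
  symm := ⟨fun _ _ h => h.symm⟩
  loopless := ⟨fun x h => G.loopless.irrefl x.1 h⟩

/-- The cluster `R_v`, the independent set of `r` vertices that replaces `v`. -/
def cluster (r : ℕ) (v : V) : Set (V × Fin r) := {x | x.1 = v}

/-- `ForceStep G r B B'`: with `B` the set of blue vertices of the `r`-blowup, some blue vertex `u`
and some connected component `W` of the white part satisfy `|N(u) ∩ W| ≤ r`, and `B'` is obtained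
from `B` by colouring all of `N(u) ∩ W` blue. -/
def ForceStep (G : SimpleGraph V) (r : ℕ) (B B' : Set (V × Fin r)) : Prop :=
  ∃ u ∈ B, ∃ W : ((blowup G r).induce Bᶜ).ConnectedComponent,
    ((blowup G r).neighborSet u ∩ (Subtype.val '' W.supp)).ncard ≤ r ∧
    B' = B ∪ ((blowup G r).neighborSet u ∩ (Subtype.val '' W.supp))

/-- `B` is an `r`-fold PSD forcing set for `G`: repeated forcing turns the whole blowup blue. -/
def IsForcingSet (G : SimpleGraph V) (r : ℕ) (B : Set (V × Fin r)) : Prop :=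
  Relation.ReflTransGen (ForceStep G r) B Set.univ

/-- The `r`-fold PSD forcing number: the least cardinality of an `r`-fold PSD forcing set. -/
noncomputable def forcingNumber (G : SimpleGraph V) (r : ℕ) : ℕ :=
  sInf {k | ∃ B : Set (V × Fin r), IsForcingSet G r B ∧ B.ncard = k}

/-- The fractional PSD forcing number, the infimum over `r ≥ 1` of the `r`-fold PSD forcing number
divided by `r`. -/
noncomputable def fractionalForcingNumber (G : SimpleGraph V) : ℝ :=
  ⨅ r : ℕ+, (forcingNumber G (r : ℕ) : ℝ) / ((r : ℕ) : ℝ)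

/-- A minimum `r`-fold PSD forcing set. -/
def IsMinimumForcingSet (G : SimpleGraph V) (r : ℕ) (B : Set (V × Fin r)) : Prop :=
  IsForcingSet G r B ∧ ∀ B' : Set (V × Fin r), IsForcingSet G r B' → B.ncard ≤ B'.ncard

/-- `R_v` is an All cluster: all its vertices are blue. -/
def IsAllCluster {r : ℕ} (B : Set (V × Fin r)) (v : V) : Prop :=
  cluster r v ⊆ B

/-- `R_v` is a One cluster: exactly one vertex is blue and the rest (at least one vertex) is white.
The last clause only matters for `r = 1`, where a blue cluster counts as All and not as One. -/
def IsOneCluster {r : ℕ} (B : Set (V × Fin r)) (v : V) : Prop :=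
  (cluster r v ∩ B).ncard = 1 ∧ ¬ cluster r v ⊆ B

/-- `R_v` is a None cluster: all its vertices are white. -/
def IsNoneCluster {r : ℕ} (B : Set (V × Fin r)) (v : V) : Prop :=
  Disjoint (cluster r v) B

/-- Every cluster is an All, One or None cluster. -/
def IsAON {r : ℕ} (B : Set (V × Fin r)) : Prop :=
  ∀ v : V, IsAllCluster B v ∨ IsOneCluster B v ∨ IsNoneCluster B v

/-- The number `a(B)` of All clusters. -/
noncomputable def numAll {r : ℕ} (B : Set (V × Fin r)) : ℕ := {v : V | IsAllCluster B v}.ncard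

/-- The number `ℓ(B)` of One clusters. -/
noncomputable def numOne {r : ℕ} (B : Set (V × Fin r)) : ℕ := {v : V | IsOneCluster B v}.ncard

/-- A forcing step in which exactly one cluster is forced into, that is, exactly one cluster
contains vertices that change from white to blue. -/
def SingleClusterStep (G : SimpleGraph V) (r : ℕ) (B B' : Set (V × Fin r)) : Prop :=
  ForceStep G r B B' ∧ ∃! v : V, (cluster r v ∩ (B' \ B)).Nonempty

/-- An optimal All-One-None `r`-fold PSD forcing set: an All-One-None minimum `r`-fold PSD forcing
set from which the blowup can be forced with exactly one cluster forced into at each step. -/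
def IsOptimalAON (G : SimpleGraph V) (r : ℕ) (B : Set (V × Fin r)) : Prop :=
  IsAON B ∧ IsMinimumForcingSet G r B ∧
    Relation.ReflTransGen (SingleClusterStep G r) B Set.univ

/-- `a*(G)`: the number of All clusters of an optimal All-One-None `n`-fold PSD forcing set, where
`n` is the order of `G`. (That there is such a set, and that the number does not depend on it, is
not part of this definition and has to be proved.) -/
noncomputable def aStar [Fintype V] (G : SimpleGraph V) : ℕ :=
  sInf {k | ∃ B : Set (V × Fin (Fintype.card V)),
    IsOptimalAON G (Fintype.card V) B ∧ numAll B = k}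

/-- `ℓ*(G)`: the number of One clusters of an optimal All-One-None `n`-fold PSD forcing set, where
`n` is the order of `G`, with the same proviso. -/
noncomputable def ellStar [Fintype V] (G : SimpleGraph V) : ℕ :=
  sInf {k | ∃ B : Set (V × Fin (Fintype.card V)),
    IsOptimalAON G (Fintype.card V) B ∧ numOne B = k}

end FracPSD

/-! The blowup can be traded for a game on `G` itself. A pair `(A, L)` of fully and partially blue
vertices wins if forces with a single target in a component of `G` minus the fully blue set turn
everything fully blue. A winning pair yields, for every `r`, a forcing set with at most `r|A| + |L|`
vertices (`Wins.reflTransGen`). Conversely, a forcing set `B` yields a winning pair with `r|A| + |L|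
≤ |B|` (`IsForcingSet.exists_wins`). For the converse, suppose a force fills the clusters of `Y`. At
most `r` of their vertices were white, so the blue ones pay for moving all of `Y` but one vertex
into `A`; the game then forces the remaining one. If the forcing vertex lies in a partial cluster,
it pays for that cluster's entry in `L`. `Invariant` ensures that no blue vertex pays twice. Hence
the `r`-fold number is the minimum of `r|A| + |L|` over winning pairs. Since `|L| ≤ n`, a
lexicographically least pair attains it for all `r ≥ n`, and division by `r` leaves `|A|` in the
limit. Single-cluster forces never enlarge `A`, so the All clusters of an optimal set belong to a
winning pair; this gives uniqueness. -/

namespace FracPSD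

open Finset

universe u

/-! ### The three-colour game on `G` -/

section GameAndBlowup

variable {V : Type u}

/-- There is a path in `G` from `y` to `z` all of whose vertices after `y` avoid `S`. -/
def Conn (G : SimpleGraph V) (S : Finset V) : V → V → Prop :=
  Relation.ReflTransGen fun a b => G.Adj a b ∧ b ∉ S

theorem Conn.anti {G : SimpleGraph V} {S T : Finset V} (h : S ⊆ T) {y z : V}
    (hc : Conn G T y z) : Conn G S y z :=
  Relation.ReflTransGen.mono (fun _ _ hab => ⟨hab.1, fun hb => hab.2 (h hb)⟩) _ _ hc

theorem Conn.notMem {G : SimpleGraph V} {S : Finset V} {y z : V}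
    (hc : Conn G S y z) (hy : y ∉ S) : z ∉ S := by
  rcases Relation.ReflTransGen.cases_tail hc with h | ⟨a, -, h⟩
  · exact h ▸ hy
  · exact h.2

theorem Conn.eq_of_neighbors {G : SimpleGraph V} {S : Finset V} {y z : V}
    (hc : Conn G S y z) (hN : ∀ w, G.Adj y w → w ∈ S) : z = y := by
  rcases Relation.ReflTransGen.cases_head hc with h | ⟨a, h, -⟩
  · exact h.symm
  · exact absurd (hN a h.1) h.2

/-- A vertex connected to a vertex with a neighbour outside `S` has itself such a neighbour. -/
theorem Conn.exists_neighbor {G : SimpleGraph V} {S : Finset V} {y z : V}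
    (hc : Conn G S y z) (hy : y ∉ S) (hN : ∃ w, G.Adj y w ∧ w ∉ S) :
    ∃ w, G.Adj z w ∧ w ∉ S := by
  rcases Relation.ReflTransGen.cases_tail hc with h | ⟨a, ha, h⟩
  · exact h ▸ hN
  · exact ⟨a, h.1.symm, Conn.notMem ha hy⟩

section Game

variable [DecidableEq V]

/-- A step of the three-colour game on `G` itself: `S` is the set of fully blue vertices and `L`
the set of partially blue ones; `y` is the only neighbour of an active vertex `x` in its
component of `G - S`. -/
def GameStep (G : SimpleGraph V) (L S S' : Finset V) : Prop :=
  ∃ y ∉ S, ∃ x ∈ S ∪ L, G.Adj x y ∧ (∀ z, G.Adj x z → Conn G S y z → z = y) ∧ S' = insert y S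

/-- Reachability in the three-colour game. -/
def GameReach (G : SimpleGraph V) (L : Finset V) : Finset V → Finset V → Prop :=
  Relation.ReflTransGen (GameStep G L)

/-- The pair `(A, L)` wins the three-colour game. -/
def Wins [Fintype V] (G : SimpleGraph V) (A L : Finset V) : Prop := GameReach G L A univ

theorem GameReach.subset {G : SimpleGraph V} {L S T : Finset V} (h : GameReach G L S T) :
    S ⊆ T := by
  induction h with
  | refl => exact Subset.refl _
  | tail _ hs ih =>
    obtain ⟨y, -, x, -, -, -, rfl⟩ := hs
    exact ih.trans (subset_insert _ _)

/-- More blue vertices only shrink components, so each force stays legal, or becomes void if its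
target is in `U`. -/
theorem GameReach.union {G : SimpleGraph V} {L L' S T : Finset V} (hL : L ⊆ L') (U : Finset V)
    (h : GameReach G L S T) : GameReach G L' (S ∪ U) (T ∪ U) := by
  induction h with
  | refl => exact Relation.ReflTransGen.refl
  | @tail T T' _ hs ih =>
    obtain ⟨y, hy, x, hx, hxy, hz, rfl⟩ := hs
    by_cases hyU : y ∈ U
    · rwa [insert_union, insert_eq_of_mem (mem_union_right _ hyU)]
    · refine Relation.ReflTransGen.tail ih ⟨y, by simp [hy, hyU], x, ?_, hxy,
        fun z h1 h2 => hz z h1 (h2.anti subset_union_left), by rw [insert_union]⟩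
      rcases mem_union.1 hx with hx | hx
      · simp [hx]
      · simp [hL hx]

theorem GameReach.of_subset_union {G : SimpleGraph V} {L L' S T : Finset V} (hL : L ⊆ L' ∪ S)
    (h : GameReach G L S T) : GameReach G L' S T := by
  induction h with
  | refl => exact Relation.ReflTransGen.refl
  | @tail T T' h hs ih =>
    obtain ⟨y, hy, x, hx, hxy, hz, rfl⟩ := hs
    refine Relation.ReflTransGen.tail ih ⟨y, hy, x, ?_, hxy, hz, rfl⟩
    rcases mem_union.1 hx with hx | hx
    · simp [hx]
    · rcases mem_union.1 (hL hx) with hx | hx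
      · simp [hx]
      · simp [GameReach.subset h hx]

/-- A winning pair whose partially blue set is everything can be improved. -/
theorem Wins.exists_card_lt [Fintype V] [Nonempty V] {G : SimpleGraph V} {A : Finset V}
    (h : Wins G A univ) : ∃ L : Finset V, Wins G A L ∧ #L < Fintype.card V := by
  rcases A.eq_empty_or_nonempty with rfl | ⟨v, hv⟩
  · rcases Relation.ReflTransGen.cases_head h with h0 | ⟨S, ⟨y, hy, x, hx, hxy, hz, rfl⟩, h⟩
    · exact absurd h0.symm univ_nonempty.ne_empty
    -- The first target `y` need not be partially blue: it does not force itself, and afterwards it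
    -- is fully blue.
    · refine ⟨univ.erase y, Relation.ReflTransGen.head ⟨y, hy, x, ?_, hxy, hz, rfl⟩
        (GameReach.of_subset_union (fun z _ => ?_) h), card_erase_lt_of_mem (mem_univ y)⟩
      · simp [hxy.ne]
      · by_cases hzy : z = y <;> simp [hzy]
  · refine ⟨univ.erase v, GameReach.of_subset_union (fun z _ => ?_) h,
      card_erase_lt_of_mem (mem_univ v)⟩
    by_cases hzy : z = v <;> simp [hzy, hv]

end Game

/-! ### From winning pairs to All-One-None forcing sets -/

section Blowup

variable {G : SimpleGraph V} {r : ℕ}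

theorem conn_of_reachable {S : Finset V} {B : Set (V × Fin r)} (hS : ∀ v ∈ S, cluster r v ⊆ B)
    {p q : (Bᶜ : Set (V × Fin r))} (h : ((blowup G r).induce Bᶜ).Reachable p q) :
    Conn G S p.1.1 q.1.1 := by
  rw [SimpleGraph.reachable_iff_reflTransGen] at h
  exact Relation.ReflTransGen.lift (r := ((blowup G r).induce Bᶜ).Adj)
    (fun p : (Bᶜ : Set (V × Fin r)) => p.1.1)
    (fun a b hab => ⟨hab, fun hb => b.2 (hS _ hb rfl)⟩) _ _ h

theorem ncard_cluster (r : ℕ) (v : V) : (cluster r v).ncard = r := by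
  have : cluster r v = (fun i : Fin r => (v, i)) '' Set.univ := by
    ext ⟨a, i⟩
    simp [cluster, eq_comm]
  rw [this, Set.ncard_image_of_injective _ (fun i j h => by simpa using h), Set.ncard_univ,
    Nat.card_fin]

theorem finite_cluster (r : ℕ) (v : V) : (cluster r v).Finite := by
  rcases Nat.eq_zero_or_pos r with rfl | hr
  · exact Set.toFinite _
  · exact Set.finite_of_ncard_pos (by rwa [ncard_cluster])

/-- A step of the three-colour game is realised by single-cluster steps in the blowup. -/
theorem reflTransGen_union_cluster {S : Finset V} {u : V × Fin r} {y : V}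
    (hxy : G.Adj u.1 y) (hz : ∀ z, G.Adj u.1 z → Conn G S y z → z = y) :
    ∀ (k : ℕ) (B : Set (V × Fin r)), (cluster r y \ B).ncard ≤ k →
      (∀ v ∈ S, cluster r v ⊆ B) → u ∈ B →
      Relation.ReflTransGen (SingleClusterStep G r) B (B ∪ cluster r y) := by
  intro k
  induction k with
  | zero =>
    intro B hk _ _
    have : cluster r y ⊆ B := by
      rw [← Set.sdiff_eq_empty, ← Set.ncard_eq_zero ((finite_cluster r y).sdiff)]
      omega
    rw [Set.union_eq_left.2 this]
  | succ k ih =>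
    intro B hk hS hu
    by_cases hy : cluster r y ⊆ B
    · rw [Set.union_eq_left.2 hy]
    -- One force may not fill the cluster: if all neighbouring clusters are blue, its white vertices
    -- are separate components. Hence the induction on their number.
    obtain ⟨p, hpy, hpB⟩ := Set.not_subset.1 hy
    set W := ((blowup G r).induce Bᶜ).connectedComponentMk ⟨p, hpB⟩ with hW
    set F := (blowup G r).neighborSet u ∩ (Subtype.val '' W.supp) with hF
    have hFy : F ⊆ cluster r y := by
      rintro _ ⟨hq, q, hqW, rfl⟩
      refine hz _ hq ?_
      have := conn_of_reachable hS (SimpleGraph.ConnectedComponent.exact hqW).symm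
      rwa [show p.1 = y from hpy] at this
    have hpF : p ∈ F := by
      refine ⟨?_, ⟨p, hpB⟩, rfl, rfl⟩
      show G.Adj u.1 p.1
      rwa [show p.1 = y from hpy]
    have hstep : SingleClusterStep G r B (B ∪ F) := by
      refine ⟨⟨u, hu, W, ?_, rfl⟩, y, ⟨p, hpy, Or.inr hpF, hpB⟩, ?_⟩
      · exact (Set.ncard_le_ncard hFy (finite_cluster r y)).trans_eq (ncard_cluster r y)
      · rintro v ⟨q, hqv, hq | hq, hqB⟩
        · exact absurd hq hqB
        · exact (show q.1 = v from hqv).symm.trans (hFy hq)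
    have hlt : (cluster r y \ (B ∪ F)).ncard < (cluster r y \ B).ncard := by
      refine Set.ncard_lt_ncard ?_ ((finite_cluster r y).sdiff)
      refine ⟨Set.sdiff_subset_sdiff_right Set.subset_union_left, fun h => ?_⟩
      exact (h ⟨hpy, hpB⟩).2 (Or.inr hpF)
    have := ih (B ∪ F) (by omega) (fun v hv => (hS v hv).trans Set.subset_union_left) (Or.inl hu)
    rw [Set.union_assoc, Set.union_eq_right.2 hFy] at this
    exact Relation.ReflTransGen.head hstep this

theorem exists_reflTransGen_of_gameReach [DecidableEq V] (hr : 0 < r) {L A T : Finset V}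
    (h : GameReach G L A T) {B : Set (V × Fin r)} (hA : ∀ v ∈ A, cluster r v ⊆ B)
    (hL : ∀ v ∈ L, (cluster r v ∩ B).Nonempty) :
    ∃ B', Relation.ReflTransGen (SingleClusterStep G r) B B' ∧ B ⊆ B' ∧
      ∀ v ∈ T, cluster r v ⊆ B' := by
  induction h with
  | refl => exact ⟨B, Relation.ReflTransGen.refl, subset_rfl, hA⟩
  | @tail T T' _ hs ih =>
    obtain ⟨B', hB', hBB', hT⟩ := ih
    obtain ⟨y, hy, x, hx, hxy, hz, rfl⟩ := hs
    obtain ⟨u, hux, hu⟩ : (cluster r x ∩ B').Nonempty := by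
      rcases mem_union.1 hx with hx | hx
      · exact ⟨(x, ⟨0, hr⟩), rfl, hT x hx rfl⟩
      · exact (hL x hx).mono (Set.inter_subset_inter_right _ hBB')
    obtain rfl : u.1 = x := hux
    refine ⟨B' ∪ cluster r y, hB'.trans (reflTransGen_union_cluster hxy hz _ B' le_rfl hT hu),
      hBB'.trans Set.subset_union_left, fun v hv => ?_⟩
    rcases mem_insert.1 hv with rfl | hv
    · exact Set.subset_union_right
    · exact (hT v hv).trans Set.subset_union_left

/-- The vertex set of the blowup that consists of the clusters of `A` and of one vertex of each
cluster of `L`. -/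
def aonSet (r : ℕ) (A L : Finset V) : Set (V × Fin r) :=
  {p | p.1 ∈ A ∨ p.1 ∈ L ∧ p.2.val = 0}

theorem Wins.reflTransGen [DecidableEq V] [Fintype V] {A L : Finset V} (h : Wins G A L) (r : ℕ) :
    Relation.ReflTransGen (SingleClusterStep G r) (aonSet r A L) Set.univ := by
  rcases Nat.eq_zero_or_pos r with rfl | hr
  · rw [Subsingleton.elim (aonSet 0 A L) Set.univ]
  obtain ⟨B', hB', -, hT⟩ := exists_reflTransGen_of_gameReach hr h (B := aonSet r A L)
    (fun v hv p hp => Or.inl (by rwa [show p.1 = v from hp]))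
    (fun v hv => ⟨(v, ⟨0, hr⟩), rfl, Or.inr ⟨hv, rfl⟩⟩)
  have : B' = Set.univ := Set.eq_univ_of_forall fun p => hT p.1 (mem_univ _) rfl
  rwa [this] at hB'

theorem isForcingSet_of_singleClusterSteps {B : Set (V × Fin r)}
    (h : Relation.ReflTransGen (SingleClusterStep G r) B Set.univ) : IsForcingSet G r B :=
  Relation.ReflTransGen.mono (fun _ _ h => h.1) _ _ h

theorem ncard_eq_sum_cluster [Fintype V] (X : Set (V × Fin r)) :
    X.ncard = ∑ v, (cluster r v ∩ X).ncard := by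
  classical
  rw [Set.ncard_eq_toFinset_card', card_eq_sum_card_fiberwise (f := Prod.fst) (t := univ)
    (fun _ _ => mem_univ _)]
  refine sum_congr rfl fun v _ => ?_
  rw [Set.ncard_eq_toFinset_card']
  congr 1
  ext p
  rw [Set.mem_toFinset, mem_filter, Set.mem_toFinset]
  exact and_comm

theorem ncard_cluster_inter_aonSet (hr : 0 < r) (A L : Finset V) (v : V) [DecidableEq V] :
    (cluster r v ∩ aonSet r A L).ncard = if v ∈ A then r else if v ∈ L then 1 else 0 := by
  split_ifs with h1 h2
  · rw [Set.inter_eq_left.2, ncard_cluster]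
    exact fun p hp => Or.inl (by rwa [show p.1 = v from hp])
  · rw [Set.ncard_eq_one]
    refine ⟨(v, ⟨0, hr⟩), ?_⟩
    ext ⟨a, i⟩
    simp only [cluster, aonSet, Set.mem_inter_iff, Set.mem_ofPred_eq, Set.mem_singleton_iff,
      Prod.mk.injEq, Fin.ext_iff]
    constructor
    · rintro ⟨rfl, h | h⟩
      · exact absurd h h1
      · exact ⟨rfl, h.2⟩
    · rintro ⟨rfl, h⟩
      exact ⟨rfl, Or.inr ⟨h2, h⟩⟩
  · rw [Set.ncard_eq_zero ((finite_cluster r v).inter_of_left _)]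
    ext ⟨a, i⟩
    simp only [cluster, aonSet, Set.mem_inter_iff, Set.mem_ofPred_eq, Set.mem_empty_iff_false,
      iff_false]
    rintro ⟨rfl, h | h⟩
    · exact h1 h
    · exact h2 h.1

theorem ncard_aonSet_le [Fintype V] (A L : Finset V) :
    (aonSet r A L).ncard ≤ r * #A + #L := by
  classical
  rcases Nat.eq_zero_or_pos r with rfl | hr
  · rw [Subsingleton.elim (aonSet 0 A L) ∅]; simp
  rw [ncard_eq_sum_cluster]
  calc _ ≤ ∑ v, ((if v ∈ A then r else 0) + if v ∈ L then 1 else 0) := by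
        refine sum_le_sum fun v _ => ?_
        rw [ncard_cluster_inter_aonSet hr]
        split_ifs <;> omega
    _ = _ := by simp [sum_add_distrib, mul_comm]

theorem isAON_aonSet (A L : Finset V) : IsAON (aonSet r A L) := by
  classical
  intro v
  rcases Nat.eq_zero_or_pos r with rfl | hr
  · exact Or.inl fun p => p.2.elim0
  by_cases hv : cluster r v ⊆ aonSet r A L
  · exact Or.inl hv
  have h := ncard_cluster_inter_aonSet hr A L v
  rw [if_neg (fun hA => hv fun p hp => Or.inl (by rwa [show p.1 = v from hp]))] at h
  split_ifs at h with h2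
  · exact Or.inr (Or.inl ⟨h, hv⟩)
  · refine Or.inr (Or.inr ?_)
    rw [Set.ncard_eq_zero ((finite_cluster r v).inter_of_left _)] at h
    exact Set.disjoint_iff_inter_eq_empty.2 h

theorem IsAON.ncard_eq [Fintype V] {B : Set (V × Fin r)} (hB : IsAON B) :
    B.ncard = r * numAll B + numOne B := by
  classical
  rw [ncard_eq_sum_cluster]
  calc _ = ∑ v, ((if IsAllCluster B v then r else 0) + if IsOneCluster B v then 1 else 0) := by
        refine sum_congr rfl fun v _ => ?_
        by_cases hA : IsAllCluster B v
        · have hO : ¬ IsOneCluster B v := fun h => h.2 hA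
          rw [if_pos hA, if_neg hO, Set.inter_eq_left.2 hA, ncard_cluster, add_zero]
        · rcases hB v with h | h | h
          · exact absurd h hA
          · rw [if_neg hA, if_pos h, h.1, zero_add]
          · have h0 : (cluster r v ∩ B).ncard = 0 := by
              rw [Set.disjoint_iff_inter_eq_empty.1 h, Set.ncard_empty]
            have hO : ¬ IsOneCluster B v := fun h => by rw [h.1] at h0; omega
            rw [if_neg hA, if_neg hO, h0]
    _ = _ := by
        rw [sum_add_distrib, ← sum_filter, ← sum_filter, sum_const, sum_const, smul_eq_mul,
          smul_eq_mul, mul_one, mul_comm, numAll, numOne, Set.ncard_eq_toFinset_card',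
          Set.ncard_eq_toFinset_card', Set.toFinset_ofPred, Set.toFinset_ofPred]

theorem numAll_add_numOne_le [Fintype V] (B : Set (V × Fin r)) :
    numAll B + numOne B ≤ Fintype.card V := by
  rw [numAll, numOne, ← Set.ncard_union_eq, ← Nat.card_eq_fintype_card]
  · exact Set.ncard_le_card _
  · exact Set.disjoint_left.2 fun v h h' => h'.2 h

end Blowup

end GameAndBlowup

/-! ### From forcing sets to winning pairs -/

section ForcingToGame

variable {V : Type u} {G : SimpleGraph V} {r : ℕ}

/-- If `z` is reached from `y` by a nontrivial path that avoids the blue clusters, then the white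
vertices of the clusters of `y` and `z` lie in one component of the white part. -/
theorem reachable_of_transGen {S : Finset V} {B : Set (V × Fin r)}
    (hS : ∀ v ∉ S, ¬ cluster r v ⊆ B) {y z : V}
    (h : Relation.TransGen (fun a b => G.Adj a b ∧ b ∉ S) y z)
    {j i : Fin r} (hj : (y, j) ∉ B) (hi : (z, i) ∉ B) :
    ((blowup G r).induce Bᶜ).Reachable ⟨(y, j), hj⟩ ⟨(z, i), hi⟩ := by
  induction h generalizing i with
  | single h => exact SimpleGraph.Adj.reachable h.1
  | @tail a b ha h ih =>
    have haS : a ∉ S := by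
      obtain ⟨_, _, h'⟩ := Relation.TransGen.tail'_iff.1 ha
      exact h'.2
    obtain ⟨⟨a', k⟩, hk, hkB⟩ := Set.not_subset.1 (hS a haS)
    obtain rfl : a' = a := hk
    exact (ih hkB).trans (SimpleGraph.Adj.reachable h.1)

/-- Vertices of one cluster are not adjacent, so a path of length zero in `G` does not connect them
in the blowup; a detour to a non-full neighbour and back does. -/
theorem Conn.transGen {S : Finset V} {y z : V} (h : Conn G S y z) (hy : y ∉ S)
    (hN : ∃ w, G.Adj y w ∧ w ∉ S) :
    Relation.TransGen (fun a b => G.Adj a b ∧ b ∉ S) y z := by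
  rcases Relation.reflTransGen_iff_eq_or_transGen.1 h with rfl | h
  · obtain ⟨w, hw, hwS⟩ := hN
    exact Relation.TransGen.tail (Relation.TransGen.single ⟨hw, hwS⟩) ⟨hw.symm, hy⟩
  · exact h

/-- The set of vertices whose clusters are blue. -/
noncomputable def fullSet [Fintype V] (B : Set (V × Fin r)) : Finset V :=
  open Classical in univ.filter fun v => cluster r v ⊆ B

theorem mem_fullSet [Fintype V] {B : Set (V × Fin r)} {v : V} :
    v ∈ fullSet B ↔ cluster r v ⊆ B := by
  simp [fullSet]

theorem fullSet_mono [Fintype V] {B B' : Set (V × Fin r)} (h : B ⊆ B') :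
    fullSet B ⊆ fullSet B' :=
  fun _ hv => mem_fullSet.2 ((mem_fullSet.1 hv).trans h)

theorem card_fullSet [Fintype V] (B : Set (V × Fin r)) : #(fullSet B) = numAll B := by
  rw [numAll, ← Set.ncard_coe_finset]
  congr 1
  ext v
  exact mem_fullSet

variable [Fintype V] [DecidableEq V]

/-- The invariant of a forcing process that starts from `B₀` and has arrived at `B`. -/
structure Invariant (G : SimpleGraph V) (B₀ : Set (V × Fin r)) (A L : Finset V)
    (B : Set (V × Fin r)) : Prop where
  reach : GameReach G L A (fullSet B)
  -- Only initially blue vertices in clusters already full or listed in `L` have been spent.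
  card_le : r * #A + #L ≤ ∑ v ∈ fullSet B ∪ L, (cluster r v ∩ B₀).ncard
  -- A force can leave a cluster partial only if all its neighbour clusters are full; the blue
  -- vertices of the others are initial, hence available as payment.
  unchanged : ∀ v ∉ fullSet B, (∃ w, G.Adj v w ∧ w ∉ fullSet B) →
    cluster r v ∩ B = cluster r v ∩ B₀
  -- Thus a cluster charged for `L` is never charged again in a later `Y`.
  isolated : ∀ v ∈ L, v ∉ fullSet B → ∀ w, G.Adj v w → w ∈ fullSet B

theorem invariant_init (B₀ : Set (V × Fin r)) : Invariant G B₀ (fullSet B₀) ∅ B₀ where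
  reach := Relation.ReflTransGen.refl
  card_le := by
    rw [card_empty, add_zero, union_empty, mul_comm, ← smul_eq_mul, ← sum_const]
    refine sum_le_sum fun v hv => ?_
    rw [Set.inter_eq_left.2 (mem_fullSet.1 hv), ncard_cluster]
  unchanged _ _ _ := rfl
  isolated := by simp

/-- A force into a single cluster all of whose neighbour clusters are blue. -/
theorem Invariant.step_isolated {B₀ B B' : Set (V × Fin r)} {A L : Finset V}
    (h : Invariant G B₀ A L B) {x y : V} (hxy : G.Adj x y)
    (hN : ∀ w, G.Adj y w → w ∈ fullSet B) (hBB' : B ⊆ B') (hB' : B' ⊆ B ∪ cluster r y) :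
    Invariant G B₀ A L B' := by
  have hne : ∀ v, v ≠ y → cluster r v ∩ B' = cluster r v ∩ B := fun v hv => by
    refine Set.Subset.antisymm (fun p hp => ⟨hp.1, ?_⟩) (Set.inter_subset_inter_right _ hBB')
    exact (hB' hp.2).resolve_right fun hpy => hv ((show p.1 = v from hp.1).symm.trans hpy)
  have hmono := fullSet_mono hBB'
  have hfull : fullSet B' ⊆ insert y (fullSet B) := fun v hv => by
    by_cases hvy : v = y
    · simp [hvy]
    · rw [mem_insert, mem_fullSet, ← Set.inter_eq_left, ← hne v hvy, Set.inter_eq_left]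
      exact Or.inr (mem_fullSet.1 hv)
  refine ⟨?_, h.card_le.trans (sum_le_sum_of_subset (union_subset_union_left hmono)), ?_,
    fun v hv hvB w hw => hmono (h.isolated v hv (fun hv' => hvB (hmono hv')) w hw)⟩
  · by_cases hy : y ∈ fullSet B'
    · have he : fullSet B' = insert y (fullSet B) :=
        hfull.antisymm (insert_subset hy hmono)
      by_cases hyB : y ∈ fullSet B
      · rw [he, insert_eq_of_mem hyB]
        exact h.reach
      · exact h.reach.tail ⟨y, hyB, x, mem_union_left _ (hN x hxy.symm), hxy,
          fun z _ hz => hz.eq_of_neighbors hN, he⟩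
    · have he : fullSet B' = fullSet B := by
        refine Subset.antisymm (fun v hv => ?_) hmono
        exact (mem_insert.1 (hfull hv)).resolve_left fun hvy => hy (hvy ▸ hv)
      rw [he]
      exact h.reach
  · rintro v hv ⟨w, hw, hwB⟩
    have hwB' : w ∉ fullSet B := fun hwB' => hwB (hmono hwB')
    have hvy : v ≠ y := fun hvy => hwB' (hN w (hvy ▸ hw))
    rw [hne v hvy]
    exact h.unchanged v (fun hv' => hv (hmono hv')) ⟨w, hw, hwB'⟩

/-- A force from the cluster of `x` that makes the clusters of `Y` blue. -/
theorem Invariant.step_multi {B₀ B B' : Set (V × Fin r)} {A L Y : Finset V}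
    (h : Invariant G B₀ A L B) {x y : V} (hy : y ∈ Y) (hx : (cluster r x ∩ B).Nonempty)
    (hY : ∀ z, z ∈ Y ↔ G.Adj x z ∧ z ∉ fullSet B ∧ Conn G (fullSet B) y z)
    (hN : ∃ w, G.Adj y w ∧ w ∉ fullSet B)
    (hle : ∑ z ∈ Y, (cluster r z \ B).ncard ≤ r)
    (hB' : B' = B ∪ {p | p.1 ∈ Y}) :
    ∃ L', Invariant G B₀ (A ∪ Y.erase y) L' B' := by
  have hyS : y ∉ fullSet B := ((hY y).1 hy).2.1
  have hxy : G.Adj x y := ((hY y).1 hy).1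
  have hYN : ∀ z ∈ Y, ∃ w, G.Adj z w ∧ w ∉ fullSet B := fun z hz =>
    ((hY z).1 hz).2.2.exists_neighbor hyS hN
  have hYS : Disjoint (fullSet B) Y := disjoint_right.2 fun z hz => ((hY z).1 hz).2.1
  have hYL : Disjoint L Y := disjoint_right.2 fun z hz hzL => by
    obtain ⟨w, hw, hwS⟩ := hYN z hz
    exact hwS (h.isolated z hzL ((hY z).1 hz).2.1 w hw)
  have hne : ∀ v ∉ Y, cluster r v ∩ B' = cluster r v ∩ B := fun v hv => by
    rw [hB', Set.inter_union_distrib_left, Set.union_eq_left]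
    rintro p ⟨hpv, hpY⟩
    exact absurd ((show p.1 = v from hpv) ▸ hpY) hv
  have hfull : fullSet B' = fullSet B ∪ Y := by
    ext v
    by_cases hv : v ∈ Y
    · simp only [mem_union, hv, or_true, iff_true, mem_fullSet, hB']
      exact fun p hp => Or.inr (by rwa [Set.mem_ofPred_eq, show p.1 = v from hp])
    · rw [mem_union, or_iff_left hv, mem_fullSet, mem_fullSet, ← Set.inter_eq_left, hne v hv,
        Set.inter_eq_left]
  -- the blue vertices in the clusters of `Y`
  have hsum : r * #Y ≤ ∑ z ∈ Y, (cluster r z ∩ B₀).ncard + r := by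
    calc r * #Y = ∑ z ∈ Y, ((cluster r z ∩ B).ncard + (cluster r z \ B).ncard) := by
          rw [mul_comm, ← smul_eq_mul, ← sum_const]
          refine sum_congr rfl fun z _ => ?_
          rw [Set.ncard_inter_add_ncard_sdiff_eq_ncard _ _ (finite_cluster r z), ncard_cluster]
      _ ≤ _ := by
          rw [sum_add_distrib]
          refine add_le_add (sum_le_sum fun z hz => ?_) hle
          rw [h.unchanged z ((hY z).1 hz).2.1 (hYN z hz)]
  -- `A` gains at most `|Y| - 1` vertices, matching the `r(|Y| - 1)` initial blue vertices found by
  -- `hsum`.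
  have hcard : r * #(A ∪ Y.erase y) + r ≤ r * #A + r * #Y := by
    have h1 := card_union_le A (Y.erase y)
    have h2 := card_erase_add_one hy
    calc r * #(A ∪ Y.erase y) + r = r * (#(A ∪ Y.erase y) + 1) := by ring
      _ ≤ r * (#A + #Y) := Nat.mul_le_mul_left _ (by omega)
      _ = _ := by ring
  have hreach : ∀ L', L ⊆ L' → x ∈ fullSet B ∪ L' →
      GameReach G L' (A ∪ Y.erase y) (fullSet B') := fun L' hL hxL => by
    refine Relation.ReflTransGen.tail (GameReach.union hL (Y.erase y) h.reach)
      ⟨y, ?_, x, ?_, hxy, fun z hz hc => ?_, ?_⟩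
    · simp [hyS]
    · rcases mem_union.1 hxL with hx | hx <;> simp [hx]
    · have hzn : z ∉ fullSet B ∪ Y.erase y := hc.notMem (by simp [hyS])
      by_contra hzy
      refine hzn (mem_union_right _ (mem_erase.2 ⟨hzy, (hY z).2 ⟨hz, ?_, ?_⟩⟩))
      · exact fun hzS => hzn (mem_union_left _ hzS)
      · exact hc.anti subset_union_left
    · rw [hfull, ← union_insert, insert_erase hy]
  have hunch : ∀ v ∉ fullSet B', (∃ w, G.Adj v w ∧ w ∉ fullSet B') →
      cluster r v ∩ B' = cluster r v ∩ B₀ := by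
    rw [hfull]
    rintro v hv ⟨w, hw, hwS⟩
    rw [mem_union, not_or] at hv hwS
    rw [hne v hv.2]
    exact h.unchanged v hv.1 ⟨w, hw, hwS.1⟩
  have hiso : ∀ v ∈ L, v ∉ fullSet B' → ∀ w, G.Adj v w → w ∈ fullSet B' := by
    rw [hfull]
    intro v hv hvS w hw
    rw [mem_union, not_or] at hvS
    exact mem_union_left _ (h.isolated v hv hvS.1 w hw)
  by_cases hxL : x ∈ fullSet B ∪ L
  · refine ⟨L, hreach L subset_rfl hxL, ?_, hunch, hiso⟩
    rw [hfull, union_right_comm, sum_union (disjoint_union_left.2 ⟨hYS, hYL⟩)]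
    have := h.card_le
    omega
  · obtain ⟨hxS, hxL'⟩ := not_or.1 (fun h => hxL (mem_union.2 h))
    have hxY : x ∉ Y := fun hxY => G.loopless.irrefl x ((hY x).1 hxY).1
    refine ⟨insert x L, hreach _ (subset_insert _ _) (by simp), ?_, hunch, fun v hv => ?_⟩
    · have h1 : 0 < (cluster r x ∩ B₀).ncard := by
        rw [← h.unchanged x hxS ⟨y, hxy, hyS⟩]
        exact (Set.ncard_pos ((finite_cluster r x).inter_of_left _)).2 hx
      rw [hfull, union_insert, union_right_comm, sum_insert (by simp [hxS, hxL', hxY]),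
        sum_union (disjoint_union_left.2 ⟨hYS, hYL⟩), card_insert_of_notMem hxL']
      have := h.card_le
      omega
    · rcases mem_insert.1 hv with rfl | hv
      · intro _ w hw
        rw [hfull, mem_union]
        by_cases hwS : w ∈ fullSet B
        · exact Or.inl hwS
        -- As `x` is not full, the path `y, x, w` puts every non-full neighbour of `x` into `Y`.
        · refine Or.inr ((hY w).2 ⟨hw, hwS, ?_⟩)
          exact (Relation.ReflTransGen.single ⟨hxy.symm, hxS⟩).tail ⟨hw, hwS⟩
      · exact hiso v hv

theorem Invariant.step {B₀ B B' : Set (V × Fin r)} {A L : Finset V}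
    (h : Invariant G B₀ A L B) (hs : ForceStep G r B B') :
    ∃ A' L', Invariant G B₀ A' L' B' ∧ (SingleClusterStep G r B B' → A' = A) := by
  obtain ⟨u, hu, W, hcard, rfl⟩ := id hs
  set F := (blowup G r).neighborSet u ∩ (Subtype.val '' W.supp) with hF
  rcases F.eq_empty_or_nonempty with hF0 | ⟨⟨y, j⟩, hadj, ⟨p, hpB⟩, hpW, rfl⟩
  · rw [hF0, Set.union_empty]
    exact ⟨A, L, h, fun _ => rfl⟩
  have hS : ∀ v ∈ fullSet B, cluster r v ⊆ B := fun v => mem_fullSet.1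
  have hS' : ∀ v ∉ fullSet B, ¬ cluster r v ⊆ B := fun v hv hv' => hv (mem_fullSet.2 hv')
  have hyS : y ∉ fullSet B := fun hy => hpB (hS y hy rfl)
  have hconn : ∀ q ∈ F, Conn G (fullSet B) y q.1 := by
    rintro _ ⟨-, q, hq, rfl⟩
    exact conn_of_reachable hS (SimpleGraph.ConnectedComponent.exact (hpW.trans hq.symm))
  by_cases hN : ∀ w, G.Adj y w → w ∈ fullSet B
  · refine ⟨A, L, h.step_isolated (x := u.1) hadj hN Set.subset_union_left ?_, fun _ => rfl⟩
    exact Set.union_subset_union_right _ fun q hq => (hconn q hq).eq_of_neighbors hN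
  push Not at hN
  classical
  set Y : Finset V :=
    univ.filter fun z => G.Adj u.1 z ∧ z ∉ fullSet B ∧ Conn G (fullSet B) y z with hYdef
  have hY : ∀ z, z ∈ Y ↔ G.Adj u.1 z ∧ z ∉ fullSet B ∧ Conn G (fullSet B) y z := by
    simp [hYdef]
  have hFY : F = {q | q.1 ∈ Y} \ B := by
    ext q
    constructor
    · intro hq
      have hqB : q ∉ B := by
        obtain ⟨-, q, -, rfl⟩ := hq
        exact q.2
      exact ⟨(hY _).2 ⟨hq.1, fun hqS => hqB (hS _ hqS rfl), hconn q hq⟩, hqB⟩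
    · rintro ⟨hqY, hqB⟩
      obtain ⟨h1, -, h3⟩ := (hY _).1 hqY
      refine ⟨h1, ⟨q, hqB⟩, ?_, rfl⟩
      rw [SimpleGraph.ConnectedComponent.mem_supp_iff, ← hpW]
      exact SimpleGraph.ConnectedComponent.sound
        (reachable_of_transGen hS' (h3.transGen hyS hN) hpB hqB).symm
  have hyY : y ∈ Y := (hY y).2 ⟨hadj, hyS, Relation.ReflTransGen.refl⟩
  have hle : ∑ z ∈ Y, (cluster r z \ B).ncard ≤ r := by
    refine le_trans ?_ hcard
    rw [ncard_eq_sum_cluster F]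
    refine le_trans (sum_le_sum fun z hz => ?_) (sum_le_sum_of_subset (subset_univ Y))
    refine Set.ncard_le_ncard (fun q hq => ⟨hq.1, ?_⟩) ((finite_cluster r z).inter_of_left _)
    rw [hFY]
    exact ⟨by rwa [Set.mem_ofPred_eq, show q.1 = z from hq.1], hq.2⟩
  obtain ⟨L', hL'⟩ := h.step_multi (B' := B ∪ F) hyY ⟨u, rfl, hu⟩ hY hN hle
    (by rw [hFY, Set.union_sdiff_self])
  refine ⟨_, L', hL', fun hsingle => ?_⟩
  have hmem : ∀ z ∈ Y, (cluster r z ∩ ((B ∪ F) \ B)).Nonempty := fun z hz => by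
    obtain ⟨q, hqz, hqB⟩ := Set.not_subset.1 (hS' z ((hY z).1 hz).2.1)
    refine ⟨q, hqz, Or.inr ?_, hqB⟩
    rw [hFY]
    exact ⟨by rwa [Set.mem_ofPred_eq, show q.1 = z from hqz], hqB⟩
  -- A force into a single cluster has `Y = {y}`, so nothing is added to `A`.
  rw [union_eq_left]
  intro z hz
  exact absurd (hsingle.2.unique (hmem z (mem_of_mem_erase hz)) (hmem y hyY)) (ne_of_mem_erase hz)

theorem Invariant.wins {B₀ : Set (V × Fin r)} {A L : Finset V}
    (h : Invariant G B₀ A L Set.univ) : Wins G A L ∧ r * #A + #L ≤ B₀.ncard := by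
  have hu : fullSet (Set.univ : Set (V × Fin r)) = univ := by
    ext v
    simp [mem_fullSet]
  constructor
  · have := h.reach
    rwa [hu] at this
  · have := h.card_le
    rwa [hu, union_eq_left.2 (subset_univ L), ← ncard_eq_sum_cluster] at this

/-- A forcing set of the blowup gives a winning pair that costs at most as much. -/
theorem IsForcingSet.exists_wins {B : Set (V × Fin r)} (h : IsForcingSet G r B) :
    ∃ A L, Wins G A L ∧ r * #A + #L ≤ B.ncard := by
  suffices ∃ A L, Invariant G B A L Set.univ by
    obtain ⟨A, L, h⟩ := this
    exact ⟨A, L, h.wins⟩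
  unfold IsForcingSet at h
  generalize Set.univ = C at h ⊢
  induction h with
  | refl => exact ⟨_, _, invariant_init B⟩
  | tail _ hs ih =>
    obtain ⟨A, L, h⟩ := ih
    obtain ⟨A', L', h', -⟩ := h.step hs
    exact ⟨A', L', h'⟩

/-- If every force is into a single cluster, the winning pair has the given All clusters. -/
theorem exists_wins_fullSet {B : Set (V × Fin r)}
    (h : Relation.ReflTransGen (SingleClusterStep G r) B Set.univ) :
    ∃ L, Wins G (fullSet B) L := by
  suffices ∃ L, Invariant G B (fullSet B) L Set.univ by
    obtain ⟨L, h⟩ := this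
    exact ⟨L, h.wins.1⟩
  generalize Set.univ = C at h ⊢
  induction h with
  | refl => exact ⟨_, invariant_init B⟩
  | tail _ hs ih =>
    obtain ⟨L, h⟩ := ih
    obtain ⟨A', L', h', he⟩ := h.step hs.1
    exact ⟨L', he hs ▸ h'⟩

end ForcingToGame

/-! ### Lexicographically minimal pairs and the extremal numbers -/

section Optimal

theorem IsMinimumForcingSet.forcingNumber_eq {V : Type u} {G : SimpleGraph V} {r : ℕ}
    {B : Set (V × Fin r)}
    (h : IsMinimumForcingSet G r B) : forcingNumber G r = B.ncard := by
  refine le_antisymm (Nat.sInf_le ⟨B, h.1, rfl⟩) (le_csInf ⟨_, B, h.1, rfl⟩ ?_)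
  rintro _ ⟨B', hB', rfl⟩
  exact h.2 B' hB'

variable {V : Type u} [Fintype V] [DecidableEq V] {G : SimpleGraph V}

/-- A winning pair that is lexicographically minimal. -/
structure IsOptimalPair (G : SimpleGraph V) (A L : Finset V) : Prop where
  wins : Wins G A L
  le : ∀ A' L', Wins G A' L' → #A < #A' ∨ #A = #A' ∧ #L ≤ #L'

theorem exists_isOptimalPair (G : SimpleGraph V) : ∃ A L, IsOptimalPair G A L := by
  classical
  obtain ⟨p, hp, hmin⟩ := exists_min_image
    (univ.filter fun p : Finset V × Finset V => Wins G p.1 p.2)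
    (fun p => toLex (#p.1, #p.2)) ⟨(univ, ∅), mem_filter.2 ⟨mem_univ _, Relation.ReflTransGen.refl⟩⟩
  refine ⟨p.1, p.2, (mem_filter.1 hp).2, fun A' L' h => ?_⟩
  simpa [Prod.Lex.toLex_le_toLex] using hmin (A', L') (mem_filter.2 ⟨mem_univ _, h⟩)

variable {A L : Finset V}

/-- Strictness matters at `r = n`, where `|L| = n` could be traded for one more All cluster. -/
theorem IsOptimalPair.card_lt [Nonempty V] (h : IsOptimalPair G A L) : #L < Fintype.card V := by
  refine lt_of_le_of_ne (card_le_univ L) fun hL => ?_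
  obtain rfl : L = univ := (card_eq_iff_eq_univ L).1 hL
  obtain ⟨L', h1, h2⟩ := h.wins.exists_card_lt
  have := h.le _ _ h1
  omega

theorem IsOptimalPair.mul_card_le (h : IsOptimalPair G A L) {r : ℕ} {B : Set (V × Fin r)}
    (hB : IsForcingSet G r B) : r * #A ≤ B.ncard := by
  obtain ⟨A', L', hw, hc⟩ := hB.exists_wins
  have : #A ≤ #A' := by
    have := h.le _ _ hw
    omega
  have := Nat.mul_le_mul_left r this
  omega

theorem IsOptimalPair.le_ncard (h : IsOptimalPair G A L) {r : ℕ} (hr : Fintype.card V ≤ r)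
    {B : Set (V × Fin r)} (hB : IsForcingSet G r B) : r * #A + #L ≤ B.ncard := by
  obtain ⟨A', L', hw, hc⟩ := hB.exists_wins
  rcases h.le _ _ hw with h1 | ⟨h1, h2⟩
  · have h3 : r * (#A + 1) ≤ r * #A' := Nat.mul_le_mul_left r h1
    have h4 := card_le_univ L
    rw [mul_add] at h3
    omega
  · rw [← h1] at hc
    omega

theorem IsOptimalPair.ncard_aonSet (h : IsOptimalPair G A L) {r : ℕ} (hr : Fintype.card V ≤ r) :
    (aonSet r A L).ncard = r * #A + #L :=
  (ncard_aonSet_le A L).antisymm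
    (h.le_ncard hr (isForcingSet_of_singleClusterSteps (h.wins.reflTransGen r)))

theorem IsOptimalPair.isOptimalAON (h : IsOptimalPair G A L) {r : ℕ} (hr : Fintype.card V ≤ r) :
    IsOptimalAON G r (aonSet r A L) := by
  refine ⟨isAON_aonSet A L, ⟨isForcingSet_of_singleClusterSteps (h.wins.reflTransGen r),
    fun B' hB' => ?_⟩, h.wins.reflTransGen r⟩
  rw [h.ncard_aonSet hr]
  exact h.le_ncard hr hB'

theorem IsOptimalPair.forcingNumber_eq (h : IsOptimalPair G A L) {r : ℕ}
    (hr : Fintype.card V ≤ r) : forcingNumber G r = r * #A + #L := by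
  rw [(h.isOptimalAON hr).2.1.forcingNumber_eq, h.ncard_aonSet hr]

theorem IsOptimalPair.mul_card_le_forcingNumber (h : IsOptimalPair G A L) (r : ℕ) :
    r * #A ≤ forcingNumber G r := by
  refine le_csInf ⟨_, aonSet r A L,
    isForcingSet_of_singleClusterSteps (h.wins.reflTransGen r), rfl⟩ ?_
  rintro _ ⟨B, hB, rfl⟩
  exact h.mul_card_le hB

theorem IsOptimalPair.numAll_eq_and_numOne_eq (h : IsOptimalPair G A L)
    {B : Set (V × Fin (Fintype.card V))} (hB : IsOptimalAON G (Fintype.card V) B) :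
    numAll B = #A ∧ numOne B = #L := by
  have hle := numAll_add_numOne_le B
  have hA := card_le_univ A
  have hL := card_le_univ L
  rcases isEmpty_or_nonempty V with hV | hV
  · have := Fintype.card_eq_zero (α := V)
    omega
  have hlt := h.card_lt
  have hcard : Fintype.card V * numAll B + numOne B = Fintype.card V * #A + #L := by
    rw [← hB.1.ncard_eq, ← h.forcingNumber_eq le_rfl, hB.2.1.forcingNumber_eq]
  obtain ⟨L', hw⟩ := exists_wins_fullSet hB.2.2
  have hge : #A ≤ numAll B := by
    rw [← card_fullSet]
    have := h.le _ _ hw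
    omega
  obtain ⟨d, hd⟩ := Nat.exists_eq_add_of_le hge
  rw [hd, mul_add] at hcard
  rcases Nat.eq_zero_or_pos d with rfl | hd0
  · rw [mul_zero] at hcard
    omega
  -- A surplus of All clusters would cost at least `n > |L|`.
  · have := Nat.le_mul_of_pos_right (Fintype.card V) hd0
    omega

theorem IsOptimalPair.aStar_eq (h : IsOptimalPair G A L) : aStar G = #A := by
  have : {k | ∃ B : Set (V × Fin (Fintype.card V)),
      IsOptimalAON G (Fintype.card V) B ∧ numAll B = k} = {#A} := by
    ext k
    constructor
    · rintro ⟨B, hB, rfl⟩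
      exact (h.numAll_eq_and_numOne_eq hB).1
    · rintro rfl
      exact ⟨_, h.isOptimalAON le_rfl, (h.numAll_eq_and_numOne_eq (h.isOptimalAON le_rfl)).1⟩
  rw [aStar, this, csInf_singleton]

theorem IsOptimalPair.ellStar_eq (h : IsOptimalPair G A L) : ellStar G = #L := by
  have : {k | ∃ B : Set (V × Fin (Fintype.card V)),
      IsOptimalAON G (Fintype.card V) B ∧ numOne B = k} = {#L} := by
    ext k
    constructor
    · rintro ⟨B, hB, rfl⟩
      exact (h.numAll_eq_and_numOne_eq hB).2
    · rintro rfl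
      exact ⟨_, h.isOptimalAON le_rfl, (h.numAll_eq_and_numOne_eq (h.isOptimalAON le_rfl)).2⟩
  rw [ellStar, this, csInf_singleton]

theorem IsOptimalPair.fractionalForcingNumber_eq (h : IsOptimalPair G A L) :
    fractionalForcingNumber G = #A := by
  have hlow : ∀ r : ℕ+, (#A : ℝ) ≤ (forcingNumber G (r : ℕ) : ℝ) / ((r : ℕ) : ℝ) := fun r => by
    rw [le_div_iff₀ (by exact_mod_cast r.pos), mul_comm]
    exact_mod_cast h.mul_card_le_forcingNumber r
  refine le_antisymm (le_of_forall_pos_le_add fun ε hε => ?_) (le_ciInf hlow)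
  -- For `r = n + m + 1` the formula for `r ≥ n` applies and `|L| / r < ε`.
  obtain ⟨m, hm⟩ := exists_nat_gt ((#L : ℝ) / ε)
  have hpos : 0 < Fintype.card V + m + 1 := by omega
  refine (ciInf_le ⟨_, Set.forall_mem_range.2 hlow⟩ ⟨_, hpos⟩).trans ?_
  have hposR : (0 : ℝ) < ((Fintype.card V + m + 1 : ℕ) : ℝ) := by exact_mod_cast hpos
  rw [PNat.mk_coe, h.forcingNumber_eq (by omega), div_le_iff₀ hposR]
  rw [div_lt_iff₀ hε] at hm
  push_cast at hm ⊢
  have : (0 : ℝ) ≤ (Fintype.card V + 1) * ε := by positivity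
  linarith

end Optimal

end FracPSD

theorem mainTheorem3 {V : Type*} [Fintype V] (G : SimpleGraph V) :
    -- optimal sets exist for `n = |G|`, and they all have the same numbers of All and One clusters
    (∃ B : Set (V × Fin (Fintype.card V)), FracPSD.IsOptimalAON G (Fintype.card V) B) ∧
    (∀ B : Set (V × Fin (Fintype.card V)), FracPSD.IsOptimalAON G (Fintype.card V) B →
      FracPSD.numAll B = FracPSD.aStar G ∧ FracPSD.numOne B = FracPSD.ellStar G) ∧
    -- the fractional PSD forcing number is `a*`, in particular a nonnegative integer
    FracPSD.fractionalForcingNumber G = (FracPSD.aStar G : ℝ) ∧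
    (∃ m : ℕ, FracPSD.fractionalForcingNumber G = (m : ℝ)) ∧
    -- the `r`-fold numbers for `r ≥ n`
    (∀ r : ℕ, Fintype.card V ≤ r →
      FracPSD.forcingNumber G r = r * FracPSD.aStar G + FracPSD.ellStar G) := by
  classical
  obtain ⟨A, L, h⟩ := FracPSD.exists_isOptimalPair G
  rw [h.aStar_eq, h.ellStar_eq]
  exact ⟨⟨_, h.isOptimalAON le_rfl⟩, fun B hB => h.numAll_eq_and_numOne_eq hB,
    h.fractionalForcingNumber_eq, ⟨_, h.fractionalForcingNumber_eq⟩,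
    fun r hr => h.forcingNumber_eq hr⟩
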